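/- Let $q$ be a prime power, $m\ge 1$ an integer and $\lambda\ge 1/2$ a real number. The $\lambda$-subfield weight on $\mathbb F_{q^m}$ is $\mathrm{wt}_\lambda(0)=0$, $\mathrm{wt}_\lambda(x)=1$ for $x\in\mathbb F_q\setminus\{0\}$ and $\mathrm{wt}_\lambda(x)=\lambda$ for $x\in\mathbb F_{q^m}\setminus\mathbb F_q$, extended additively over the coordinates to $\mathbb F_{q^m}^n$. For $r\ge 0$ let $B_{r,\lambda}(\mathbb F_{q^m}^n)=\{x\in\mathbb F_{q^m}^n : \mathrm{wt}_\lambda(x)\le r\}$. Let $u(n)\ge 0$ be radii such that the limit $U=\lim_{n\to\infty}u(n)/n$ exists, put $f(x)=1+(q-1)x+(q^m-q)x^\lambda$, and let $\rho\ge 0$ be a solution of $$U=\frac{\rho f'(\rho)}{f(\rho)}=\frac{(q-1)\rho+\lambda(q^m-q)\rho^\lambda}{1+(q-1)\rho+(q^m-q)\rho^\lambda},$$ where for $\rho=0$ the middle expression is disregarded and the right-hand side, which is $0$, is used. If $\rho\le 1$ (equivalently, $U$ is at most the average weight $\frac{(q-1)+\lambda(q^m-q)}{q^m}$ of an element of $\mathbb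 F_{q^m}$), then $$\lim_{n\to\infty}\frac1n\log_{q^m}\bigl|B_{u(n),\lambda}(\mathbb F_{q^m}^n)\bigr|=\log_{q^m}f(\rho)-U\log_{q^m}\rho ,$$ with the convention $0\cdot\log_{q^m}0=0$ in the case $\rho=U=0$. If $\rho>1$, then $$\lim_{n\to\infty}\frac1n\log_{q^m}\bigl|B_{u(n),\lambda}(\mathbb F_{q^m}^n)\bigr|=1 .$$ -/

import Mathlib

open Filter Topology

noncomputable section

open Classical in
/-- The `lam`-subfield weight of a single element of the extension field `K` of `F`. -/
def subfieldWeight (F : Type*) {K : Type*} [Field F] [Field K] [Algebra F K]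
    (lam : ℝ) (x : K) : ℝ :=
  if x = 0 then 0
  else if x ∈ Set.range (algebraMap F K) then 1
  else lam

/-- The `lam`-subfield weight of a vector, extended additively over the coordinates. -/
def subfieldWeightVec (F : Type*) {K : Type*} [Field F] [Field K] [Algebra F K]
    (lam : ℝ) {n : ℕ} (x : Fin n → K) : ℝ :=
  ∑ i, subfieldWeight F lam (x i)

/-- The ball of radius `r` around the origin of `K ^ n` in the `lam`-subfield metric. -/
def subfieldBall (F K : Type*) [Field F] [Field K] [Algebra F K]
    (lam : ℝ) (n : ℕ) (r : ℝ) : Set (Fin n → K) :=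
  {x | subfieldWeightVec F lam x ≤ r}

/-- The weight enumerator `1 + (q - 1) x + (q ^ m - q) x ^ lam` of the field of order `q ^ m`
over its subfield of order `q`. -/
def subfieldEnumerator (q m : ℕ) (lam x : ℝ) : ℝ :=
  1 + ((q : ℝ) - 1) * x + ((q : ℝ) ^ m - q) * x ^ lam

end

/-!
For letters drawn independently with probability proportional to `s ^ w`, where `0 < s ≤ 1`, a
word `x` of length `n` has probability `s ^ w(x) / Z(s) ^ n`, with `Z` the weight enumerator.
Words of weight at most `r` thus have probability at least `s ^ r / Z(s) ^ n`, so there are at most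
`Z(s) ^ n / s ^ r` of them. Conversely, by the law of large numbers most of the probability sits on
words of weight close to `n M(s)`, with `M(s)` the mean weight of a letter, which gives about
`Z(s) ^ n / s ^ (n M(s))` words in any ball of radius slightly above `n M(s)`. The two bounds agree
when `U = M(s)`, and `M` is strictly increasing, so the parameters just below `s` yield the lower
bound at `s`. For `U` beyond the plain average `M(1)`, taking `s = 1` already gives almost all
words.
-/

open MeasureTheory ProbabilityTheory

theorem tendsto_log_div_of_exp_bounds {a : ℕ → ℝ} {L : ℝ}
    (hlower : ∀ b < L, ∀ᶠ n : ℕ in atTop, Real.exp (b * n) ≤ a n)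
    (hupper : ∀ b > L, ∀ᶠ n : ℕ in atTop, a n ≤ Real.exp (b * n)) :
    Tendsto (fun n : ℕ => Real.log (a n) / n) atTop (𝓝 L) := by
  have hpos : ∀ᶠ n : ℕ in atTop, 0 < a n :=
    (hlower (L - 1) (sub_one_lt L)).mono fun n hn => (Real.exp_pos _).trans_le hn
  refine tendsto_order.2 ⟨fun b hb => ?_, fun b hb => ?_⟩
  · obtain ⟨c, hbc, hcL⟩ := exists_between hb
    filter_upwards [hlower c hcL, hpos, eventually_gt_atTop 0] with n hn hapos hnpos
    exact hbc.trans_le <|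
      (le_div_iff₀ (Nat.cast_pos.2 hnpos)).2 ((Real.le_log_iff_exp_le hapos).2 hn)
  · obtain ⟨c, hLc, hcb⟩ := exists_between hb
    filter_upwards [hupper c hLc, hpos, eventually_gt_atTop 0] with n hn hapos hnpos
    exact ((div_le_iff₀ (Nat.cast_pos.2 hnpos)).2 ((Real.log_le_iff_le_exp hapos).2 hn)).trans_lt
      hcb

theorem tendsto_one_div_mul_logb {a : ℕ → ℝ} {b L : ℝ}
    (h : Tendsto (fun n : ℕ => Real.log (a n) / n) atTop (𝓝 L)) :
    Tendsto (fun n : ℕ => 1 / (n : ℝ) * Real.logb b (a n)) atTop (𝓝 (L / Real.log b)) := by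
  refine (h.div_const _).congr fun n => ?_
  rw [Real.logb]
  ring

theorem pow_div_rpow_eq_exp {z s : ℝ} (hz : 0 < z) (hs : 0 < s) (n : ℕ) (r : ℝ) :
    z ^ n / s ^ r = Real.exp (Real.log z * n - Real.log s * r) := by
  rw [Real.exp_sub, ← Real.rpow_def_of_pos hz, Real.rpow_natCast, ← Real.rpow_def_of_pos hs]

theorem measureReal_pi_abs_sum_sub_ge_le {ι α : Type*} [Fintype ι] [MeasurableSpace α]
    {ν : Measure α} [IsProbabilityMeasure ν] {w : α → ℝ} (hw : MemLp w 2 ν) {c : ℝ} (hc : 0 < c) :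
    (Measure.pi fun _ : ι => ν).real {x | c ≤ |∑ i, w (x i) - Fintype.card ι * ∫ a, w a ∂ν|} ≤
      Fintype.card ι * Var[w; ν] / c ^ 2 := by
  have hcoord (i : ι) : MemLp (fun x : ι → α => w (x i)) 2 (Measure.pi fun _ => ν) :=
    hw.comp_measurePreserving (measurePreserving_eval (fun _ => ν) i)
  have hmean : ∫ x : ι → α, ∑ i, w (x i) ∂(Measure.pi fun _ => ν) =
      Fintype.card ι * ∫ a, w a ∂ν := by
    rw [integral_finsetSum _ fun i _ => (hcoord i).integrable one_le_two]
    simp [integral_comp_eval (μ := fun _ : ι => ν) hw.aestronglyMeasurable]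
  have hvar : Var[fun x : ι → α => ∑ i, w (x i); Measure.pi fun _ => ν] =
      Fintype.card ι * Var[w; ν] := by
    simpa [Finset.sum_fn] using variance_sum_pi (μ := fun _ : ι => ν) (X := fun _ => w) fun _ => hw
  have hchebyshev := meas_ge_le_variance_div_sq
    (memLp_finsetSum Finset.univ fun i _ => hcoord i) hc
  rw [hmean, hvar] at hchebyshev
  exact ENNReal.toReal_le_of_le_ofReal
    (div_nonneg (mul_nonneg (Nat.cast_nonneg _) (variance_nonneg _ _)) (sq_nonneg c)) hchebyshev

section Alphabet

variable {α : Type*}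

/-- The words of length `n` over an alphabet with letter weights `w` whose total weight is at most
`r`. -/
def weightBall (w : α → ℝ) (n : ℕ) (r : ℝ) : Set (Fin n → α) :=
  {x | ∑ i, w (x i) ≤ r}

theorem mem_weightBall {w : α → ℝ} {n : ℕ} {r : ℝ} {x : Fin n → α} :
    x ∈ weightBall w n r ↔ ∑ i, w (x i) ≤ r :=
  Iff.rfl

theorem weightBall_subset_weightBall (w : α → ℝ) (n : ℕ) {r r' : ℝ} (h : r ≤ r') :
    weightBall w n r ⊆ weightBall w n r' :=
  fun _ hx => mem_weightBall.2 ((mem_weightBall.1 hx).trans h)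

/-- The probability measure on the alphabet which gives each letter a mass proportional to
`s ^ w`, for `0 < s`. -/
noncomputable def tiltedCount [MeasurableSpace α] (w : α → ℝ) (s : ℝ) : Measure α :=
  Measure.count.tilted fun a => Real.log s * w a

instance isProbabilityMeasure_tiltedCount [Finite α] [Nonempty α] [MeasurableSpace α]
    [MeasurableSingletonClass α] (w : α → ℝ) (s : ℝ) :
    IsProbabilityMeasure (tiltedCount w s) :=
  isProbabilityMeasure_tilted Integrable.of_finite

variable [Fintype α]

/-- The weight enumerator of an alphabet with real letter weights `w`. -/
noncomputable def weightEnumerator (w : α → ℝ) (s : ℝ) : ℝ :=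
  ∑ a, s ^ w a

/-- The mean weight of a letter drawn with probability proportional to `s ^ w`; it is the
logarithmic derivative `s * Z' s / Z s` of the weight enumerator `Z`, in a form which is also
meaningful at `s = 0`. -/
noncomputable def tiltedMean (w : α → ℝ) (s : ℝ) : ℝ :=
  (∑ a, w a * s ^ w a) / weightEnumerator w s

theorem weightEnumerator_one (w : α → ℝ) : weightEnumerator w 1 = Fintype.card α := by
  simp [weightEnumerator]

theorem weightEnumerator_pos [Nonempty α] (w : α → ℝ) {s : ℝ} (hs : 0 < s) :
    0 < weightEnumerator w s :=
  Finset.sum_pos (fun _ _ => Real.rpow_pos_of_pos hs _) Finset.univ_nonempty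

theorem weightEnumerator_zero_pos {w : α → ℝ} (hw : ∃ a, w a = 0) : 0 < weightEnumerator w 0 :=
  Finset.sum_pos' (fun _ _ => Real.rpow_nonneg le_rfl _)
    (hw.imp fun a ha => ⟨Finset.mem_univ a, by simp [ha]⟩)

theorem tiltedMean_zero (w : α → ℝ) : tiltedMean w 0 = 0 := by
  have hterm (a : α) : w a * 0 ^ w a = 0 := by
    rcases eq_or_ne (w a) 0 with h | h
    · rw [h, zero_mul]
    · rw [Real.zero_rpow h, mul_zero]
  simp only [tiltedMean, hterm, Finset.sum_const_zero, zero_div]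

theorem continuous_weightEnumerator {w : α → ℝ} (hw : ∀ a, 0 ≤ w a) :
    Continuous (weightEnumerator w) :=
  continuous_finsetSum _ fun a _ => Real.continuous_rpow_const (hw a)

theorem continuousAt_weightEnumerator (w : α → ℝ) {s : ℝ} (hs : s ≠ 0) :
    ContinuousAt (weightEnumerator w) s :=
  tendsto_finsetSum _ fun a _ => Real.continuousAt_rpow_const s (w a) (Or.inl hs)

theorem continuousAt_tiltedMean [Nonempty α] (w : α → ℝ) {s : ℝ} (hs : 0 < s) :
    ContinuousAt (tiltedMean w) s := by
  have hnum : ContinuousAt (fun t => ∑ a, w a * t ^ w a) s :=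
    tendsto_finsetSum _ fun a _ =>
      (Real.continuousAt_rpow_const s (w a) (Or.inl hs.ne')).const_mul (w a)
  exact hnum.div₀ (continuousAt_weightEnumerator w hs.ne') (weightEnumerator_pos w hs).ne'

theorem rpow_mul_rpow_lt_rpow_mul_rpow {s t x y : ℝ} (hs : 0 < s) (hst : s < t) (hxy : y < x) :
    s ^ x * t ^ y < t ^ x * s ^ y := by
  have ht := hs.trans hst
  calc s ^ x * t ^ y = s ^ (x - y) * (s ^ y * t ^ y) := by
        rw [← mul_assoc, ← Real.rpow_add hs, sub_add_cancel]
    _ < t ^ (x - y) * (s ^ y * t ^ y) := by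
        gcongr
    _ = t ^ x * s ^ y := by
        rw [mul_left_comm, ← Real.rpow_add ht, sub_add_cancel, mul_comm]

theorem sub_mul_rpow_sub_pos {s t x y : ℝ} (hs : 0 < s) (hst : s < t) (hxy : x ≠ y) :
    0 < (x - y) * (t ^ x * s ^ y - s ^ x * t ^ y) := by
  rcases hxy.lt_or_gt with h | h
  · refine mul_pos_of_neg_of_neg (sub_neg.2 h) (sub_neg.2 ?_)
    simpa only [mul_comm] using rpow_mul_rpow_lt_rpow_mul_rpow hs hst h
  · exact mul_pos (sub_pos.2 h) (sub_pos.2 (rpow_mul_rpow_lt_rpow_mul_rpow hs hst h))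

theorem strictMonoOn_tiltedMean {w : α → ℝ} (hw : ∃ a b, w a ≠ w b) :
    StrictMonoOn (tiltedMean w) (Set.Ioi 0) := by
  intro s hs t ht hst
  obtain ⟨a₀, b₀, hab⟩ := hw
  have : Nonempty α := ⟨a₀⟩
  let S (a b : α) : ℝ := t ^ w a * s ^ w b - s ^ w a * t ^ w b
  have hnonneg (a b : α) : 0 ≤ (w a - w b) * S a b := by
    rcases eq_or_ne (w a) (w b) with h | h
    · rw [h, sub_self, zero_mul]
    · exact (sub_mul_rpow_sub_pos hs hst h).le
  have hpos : 0 < ∑ a, ∑ b, (w a - w b) * S a b :=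
    Finset.sum_pos' (fun a _ => Finset.sum_nonneg fun b _ => hnonneg a b)
      ⟨a₀, Finset.mem_univ _, Finset.sum_pos' (fun b _ => hnonneg a₀ b)
        ⟨b₀, Finset.mem_univ _, sub_mul_rpow_sub_pos hs hst hab⟩⟩
  -- `S` is antisymmetric, so exchanging the two letters identifies the two halves of the sum.
  have hsymm : ∑ a, ∑ b, (w a - w b) * S a b = 2 * ∑ a, ∑ b, w a * S a b := by
    have hswap : ∑ a, ∑ b, w b * S a b = -∑ a, ∑ b, w a * S a b := by
      rw [Finset.sum_comm]
      simp only [← Finset.sum_neg_distrib]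
      exact Finset.sum_congr rfl fun a _ => Finset.sum_congr rfl fun b _ => by simp only [S]; ring
    simp only [sub_mul, Finset.sum_sub_distrib, hswap]
    ring
  have hcross : ∑ a, ∑ b, w a * S a b =
      (∑ a, w a * t ^ w a) * weightEnumerator w s -
        (∑ a, w a * s ^ w a) * weightEnumerator w t := by
    simp only [S, weightEnumerator, Finset.sum_mul_sum, ← Finset.sum_sub_distrib]
    exact Finset.sum_congr rfl fun a _ => Finset.sum_congr rfl fun b _ => by ring
  rw [tiltedMean, tiltedMean,
    div_lt_div_iff₀ (weightEnumerator_pos w hs) (weightEnumerator_pos w ht)]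
  linarith

section TiltedCount

variable [MeasurableSpace α] [MeasurableSingletonClass α]

theorem integral_exp_log_mul_count (w : α → ℝ) {s : ℝ} (hs : 0 < s) :
    ∫ a, Real.exp (Real.log s * w a) ∂Measure.count = weightEnumerator w s := by
  simp only [integral_count, ← Real.rpow_def_of_pos hs, weightEnumerator]

theorem tiltedCount_real_singleton (w : α → ℝ) {s : ℝ} (hs : 0 < s) (a : α) :
    (tiltedCount w s).real {a} = s ^ w a / weightEnumerator w s := by
  have hZ : 0 ≤ weightEnumerator w s := Finset.sum_nonneg fun _ _ => Real.rpow_nonneg hs.le _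
  rw [measureReal_def, tiltedCount, tilted_apply_eq_ofReal_integral,
    integral_exp_log_mul_count w hs, integral_singleton, count_real_singleton, one_smul,
    ← Real.rpow_def_of_pos hs,
    ENNReal.toReal_ofReal (div_nonneg (Real.rpow_nonneg hs.le _) hZ)]

theorem integral_tiltedCount (w : α → ℝ) {s : ℝ} (hs : 0 < s) :
    ∫ a, w a ∂tiltedCount w s = tiltedMean w s := by
  rw [tiltedCount, integral_tilted, integral_exp_log_mul_count w hs, integral_count, tiltedMean,
    Finset.sum_div]
  refine Finset.sum_congr rfl fun a _ => ?_
  rw [smul_eq_mul, ← Real.rpow_def_of_pos hs]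
  ring

theorem pi_tiltedCount_real_singleton [Nonempty α] (w : α → ℝ) {s : ℝ} (hs : 0 < s) {n : ℕ}
    (x : Fin n → α) :
    (Measure.pi fun _ => tiltedCount w s).real {x} =
      s ^ (∑ i, w (x i)) / weightEnumerator w s ^ n := by
  rw [measureReal_def, Measure.pi_singleton, ENNReal.toReal_prod]
  simp only [← measureReal_def, tiltedCount_real_singleton w hs, Finset.prod_div_distrib,
    Real.rpow_sum_of_pos hs, Finset.prod_const, Finset.card_univ, Fintype.card_fin]

open Classical in
theorem pi_tiltedCount_real_eq_sum [Nonempty α] (w : α → ℝ) {s : ℝ} (hs : 0 < s) {n : ℕ}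
    (A : Set (Fin n → α)) :
    (Measure.pi fun _ => tiltedCount w s).real A =
      ∑ x ∈ A.toFinset, s ^ (∑ i, w (x i)) / weightEnumerator w s ^ n := by
  simp only [← pi_tiltedCount_real_singleton w hs, sum_measureReal_singleton, Set.coe_toFinset]

theorem ncard_mul_le_pi_tiltedCount_real [Nonempty α] (w : α → ℝ) {s : ℝ} (hs : 0 < s)
    (hs1 : s ≤ 1) {n : ℕ} {r : ℝ} {A : Set (Fin n → α)} (hA : ∀ x ∈ A, ∑ i, w (x i) ≤ r) :
    A.ncard * (s ^ r / weightEnumerator w s ^ n) ≤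
      (Measure.pi fun _ => tiltedCount w s).real A := by
  classical
  have hZ := weightEnumerator_pos w hs
  rw [pi_tiltedCount_real_eq_sum w hs, Set.ncard_eq_toFinset_card', ← nsmul_eq_mul]
  refine Finset.card_nsmul_le_sum _ _ _ fun x hx => ?_
  gcongr ?_ / _
  exact Real.rpow_le_rpow_of_exponent_ge hs hs1 (hA x (Set.mem_toFinset.1 hx))

theorem pi_tiltedCount_real_le_ncard_mul [Nonempty α] (w : α → ℝ) {s : ℝ} (hs : 0 < s)
    (hs1 : s ≤ 1) {n : ℕ} {r : ℝ} {A : Set (Fin n → α)} (hA : ∀ x ∈ A, r ≤ ∑ i, w (x i)) :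
    (Measure.pi fun _ => tiltedCount w s).real A ≤
      A.ncard * (s ^ r / weightEnumerator w s ^ n) := by
  classical
  have hZ := weightEnumerator_pos w hs
  rw [pi_tiltedCount_real_eq_sum w hs, Set.ncard_eq_toFinset_card', ← nsmul_eq_mul]
  refine Finset.sum_le_card_nsmul _ _ _ fun x hx => ?_
  gcongr ?_ / _
  exact Real.rpow_le_rpow_of_exponent_ge hs hs1 (hA x (Set.mem_toFinset.1 hx))

theorem mul_le_ncard_weightBall [Nonempty α] (w : α → ℝ) {s : ℝ} (hs : 0 < s) (hs1 : s ≤ 1)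
    (n : ℕ) {c : ℝ} (hc : 0 < c) :
    (1 - n * Var[w; tiltedCount w s] / c ^ 2) *
        (weightEnumerator w s ^ n / s ^ (n * tiltedMean w s - c)) ≤
      (weightBall w n (n * tiltedMean w s + c)).ncard := by
  set P : Measure (Fin n → α) := Measure.pi fun _ => tiltedCount w s
  let typical : Set (Fin n → α) := {x | c ≤ |∑ i, w (x i) - n * tiltedMean w s|}ᶜ
  have htypical {x : Fin n → α} (hx : x ∈ typical) :
      n * tiltedMean w s - c ≤ ∑ i, w (x i) ∧ ∑ i, w (x i) ≤ n * tiltedMean w s + c := by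
    have := abs_lt.1 (not_le.1 (Set.notMem_ofPred_iff.1 hx))
    constructor <;> linarith
  have hprob : 1 - n * Var[w; tiltedCount w s] / c ^ 2 ≤ P.real typical := by
    have hatypical := measureReal_pi_abs_sum_sub_ge_le (ι := Fin n)
      (MemLp.of_discrete (f := w) (p := 2) (μ := tiltedCount w s)) hc
    rw [integral_tiltedCount w hs, Fintype.card_fin] at hatypical
    rw [probReal_compl_eq_one_sub (Set.toFinite _).measurableSet]
    exact sub_le_sub_left hatypical 1
  have hmass : 0 < s ^ (n * tiltedMean w s - c) / weightEnumerator w s ^ n :=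
    div_pos (Real.rpow_pos_of_pos hs _) (pow_pos (weightEnumerator_pos w hs) n)
  have hcount := hprob.trans
    (pi_tiltedCount_real_le_ncard_mul w hs hs1 fun x hx => (htypical hx).1)
  rw [← div_le_iff₀ hmass, div_eq_mul_inv, inv_div] at hcount
  exact hcount.trans (Nat.cast_le.2 (Set.ncard_le_ncard fun x hx => (htypical hx).2))

end TiltedCount

theorem ncard_weightBall_le [Nonempty α] (w : α → ℝ) {s : ℝ} (hs : 0 < s) (hs1 : s ≤ 1) (n : ℕ)
    (r : ℝ) : ((weightBall w n r).ncard : ℝ) ≤ weightEnumerator w s ^ n / s ^ r := by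
  let _ : MeasurableSpace α := ⊤
  have hmass : 0 < s ^ r / weightEnumerator w s ^ n :=
    div_pos (Real.rpow_pos_of_pos hs r) (pow_pos (weightEnumerator_pos w hs) n)
  have hprob := (ncard_mul_le_pi_tiltedCount_real w hs hs1
    fun x (hx : x ∈ weightBall w n r) => mem_weightBall.1 hx).trans measureReal_le_one
  rwa [← le_div_iff₀ hmass, one_div_div] at hprob

theorem weightEnumerator_zero_pow_le_ncard_weightBall (w : α → ℝ) (n : ℕ) {r : ℝ} (hr : 0 ≤ r) :
    weightEnumerator w 0 ^ n ≤ (weightBall w n r).ncard := by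
  classical
  have hletter (a : α) : (0 : ℝ) ≤ 0 ^ w a := Real.rpow_nonneg le_rfl _
  have hvanish : ∀ x ∉ (weightBall w n r).toFinset, ∏ i, (0 : ℝ) ^ w (x i) = 0 := by
    intro x hx
    obtain ⟨i, -, hi⟩ : ∃ i ∈ Finset.univ, w (x i) ≠ 0 := by
      refine Finset.exists_ne_zero_of_sum_ne_zero (ne_of_gt (hr.trans_lt ?_))
      simpa only [Set.mem_toFinset, mem_weightBall, not_le] using hx
    exact Finset.prod_eq_zero (Finset.mem_univ i) (Real.zero_rpow hi)
  rw [weightEnumerator, Fintype.sum_pow, Set.ncard_eq_toFinset_card',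
    ← Finset.sum_subset (Finset.subset_univ _) fun x _ hx => hvanish x hx, Finset.card_eq_sum_ones,
    Nat.cast_sum, Nat.cast_one]
  exact Finset.sum_le_sum fun x _ =>
    Finset.prod_le_one (fun i _ => hletter _) fun i _ => Real.zero_rpow_le_one _

section Growth

variable {w : α → ℝ} {u : ℕ → ℝ} {U : ℝ}

theorem eventually_ncard_weightBall_le_exp [Nonempty α] (w : α → ℝ)
    (hU : Tendsto (fun n : ℕ => u n / (n : ℝ)) atTop (𝓝 U)) {s : ℝ} (hs : 0 < s) (hs1 : s ≤ 1)
    {b : ℝ} (hb : Real.log (weightEnumerator w s) - U * Real.log s < b) :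
    ∀ᶠ n : ℕ in atTop, ((weightBall w n (u n)).ncard : ℝ) ≤ Real.exp (b * n) := by
  have hlim := (hU.mul_const (Real.log s)).const_sub (Real.log (weightEnumerator w s))
  filter_upwards [hlim.eventually_lt_const hb, eventually_gt_atTop 0] with n hn hnpos
  have hn0 : (n : ℝ) ≠ 0 := Nat.cast_ne_zero.2 hnpos.ne'
  calc ((weightBall w n (u n)).ncard : ℝ)
      ≤ Real.exp (Real.log (weightEnumerator w s) * n - Real.log s * u n) := by
        rw [← pow_div_rpow_eq_exp (weightEnumerator_pos w hs) hs]
        exact ncard_weightBall_le w hs hs1 n (u n)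
    _ = Real.exp ((Real.log (weightEnumerator w s) - u n / n * Real.log s) * n) := by
        congr 1
        field_simp
    _ ≤ Real.exp (b * n) := by gcongr

theorem eventually_exp_le_ncard_weightBall_mul [Nonempty α] (w : α → ℝ) {s : ℝ} (hs : 0 < s)
    (hs1 : s ≤ 1) {δ : ℝ} (hδ : 0 < δ) {b : ℝ}
    (hb : b < Real.log (weightEnumerator w s) - (tiltedMean w s - δ) * Real.log s) :
    ∀ᶠ n : ℕ in atTop,
      Real.exp (b * n) ≤ (weightBall w n ((tiltedMean w s + δ) * n)).ncard := by
  let _ : MeasurableSpace α := ⊤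
  set Z := weightEnumerator w s
  set M := tiltedMean w s
  set V := Var[w; tiltedCount w s]
  set g := Real.log Z - (M - δ) * Real.log s - b
  have hdeviation : Tendsto (fun n : ℕ => 1 - V / δ ^ 2 / (n : ℝ)) atTop (𝓝 1) := by
    simpa using (tendsto_const_div_atTop_nhds_zero_nat (V / δ ^ 2)).const_sub 1
  have hgain : Tendsto (fun n : ℕ => Real.exp (g * n)) atTop atTop :=
    Real.tendsto_exp_atTop.comp (tendsto_natCast_atTop_atTop.const_mul_atTop (sub_pos.2 hb))
  filter_upwards [(hdeviation.pos_mul_atTop one_pos hgain).eventually_ge_atTop 1,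
    eventually_gt_atTop 0] with n hn hnpos
  have hn0 : (0 : ℝ) < n := Nat.cast_pos.2 hnpos
  calc Real.exp (b * n)
      ≤ (1 - V / δ ^ 2 / n) * Real.exp (g * n) * Real.exp (b * n) :=
        le_mul_of_one_le_left (Real.exp_pos _).le hn
    _ = (1 - n * V / (δ * n) ^ 2) * (Z ^ n / s ^ (n * M - δ * n)) := by
        rw [pow_div_rpow_eq_exp (weightEnumerator_pos w hs) hs, mul_assoc, ← Real.exp_add]
        congr 2
        · field_simp
        · simp only [g]
          ring
    _ ≤ (weightBall w n (n * M + δ * n)).ncard :=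
        mul_le_ncard_weightBall w hs hs1 n (mul_pos hδ hn0)
    _ = (weightBall w n ((M + δ) * n)).ncard := by rw [add_mul, mul_comm M]

theorem eventually_exp_le_ncard_weightBall [Nonempty α] (w : α → ℝ)
    (hU : Tendsto (fun n : ℕ => u n / (n : ℝ)) atTop (𝓝 U)) {s : ℝ} (hs : 0 < s) (hs1 : s ≤ 1)
    (hlt : tiltedMean w s < U) {b : ℝ}
    (hb : b < Real.log (weightEnumerator w s) - tiltedMean w s * Real.log s) :
    ∀ᶠ n : ℕ in atTop, Real.exp (b * n) ≤ (weightBall w n (u n)).ncard := by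
  obtain ⟨δ, ⟨hbδ, hδU⟩, hδ⟩ : ∃ δ : ℝ,
      (b < Real.log (weightEnumerator w s) - (tiltedMean w s - δ) * Real.log s ∧
        tiltedMean w s + δ < U) ∧ 0 < δ := by
    have hrate : ContinuousAt
        (fun δ => Real.log (weightEnumerator w s) - (tiltedMean w s - δ) * Real.log s) 0 := by
      fun_prop
    have hmean : ContinuousAt (fun δ => tiltedMean w s + δ) 0 := by fun_prop
    have hnear := (hrate.eventually_const_lt (by simpa using hb)).and
      (hmean.eventually_lt_const (by simpa using hlt))
    exact ((hnear.filter_mono nhdsWithin_le_nhds).and (self_mem_nhdsWithin (s := Set.Ioi 0))).exists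
  filter_upwards [eventually_exp_le_ncard_weightBall_mul w hs hs1 hδ hbδ,
    hU.eventually_const_lt hδU, eventually_gt_atTop 0] with n hn hun hnpos
  have hradius : (tiltedMean w s + δ) * n ≤ u n :=
    ((lt_div_iff₀ (Nat.cast_pos.2 hnpos)).1 hun).le
  exact hn.trans <| Nat.cast_le.2 <|
    Set.ncard_le_ncard (weightBall_subset_weightBall w n hradius) (Set.toFinite _)

theorem tendsto_log_ncard_weightBall_of_pos (hw : ∃ a b, w a ≠ w b) {ρ : ℝ} (hρ : 0 < ρ)
    (hρ1 : ρ ≤ 1) (hU : Tendsto (fun n : ℕ => u n / (n : ℝ)) atTop (𝓝 (tiltedMean w ρ))) :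
    Tendsto (fun n : ℕ => Real.log ((weightBall w n (u n)).ncard : ℝ) / n) atTop
      (𝓝 (Real.log (weightEnumerator w ρ) - tiltedMean w ρ * Real.log ρ)) := by
  have : Nonempty α := ⟨hw.choose⟩
  refine tendsto_log_div_of_exp_bounds (fun b hb => ?_) fun b hb =>
    eventually_ncard_weightBall_le_exp w hU hρ hρ1 hb
  have hrate : ContinuousAt
      (fun s => Real.log (weightEnumerator w s) - tiltedMean w s * Real.log s) ρ :=
    ((continuousAt_weightEnumerator w hρ.ne').log (weightEnumerator_pos w hρ).ne').sub
      ((continuousAt_tiltedMean w hρ).mul (Real.continuousAt_log hρ.ne'))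
  obtain ⟨s, ⟨hbs, hs⟩, hsρ : s < ρ⟩ :=
    ((((hrate.eventually_const_lt hb).and (eventually_gt_nhds hρ)).filter_mono
      nhdsWithin_le_nhds).and (self_mem_nhdsWithin (s := Set.Iio ρ))).exists
  exact eventually_exp_le_ncard_weightBall w hU hs (hsρ.le.trans hρ1)
    (strictMonoOn_tiltedMean hw hs hρ hsρ) hbs

theorem tendsto_log_ncard_weightBall_of_zero (hw : ∀ a, 0 ≤ w a) (hw0 : ∃ a, w a = 0)
    (hu : ∀ n, 0 ≤ u n) (hU : Tendsto (fun n : ℕ => u n / (n : ℝ)) atTop (𝓝 0)) :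
    Tendsto (fun n : ℕ => Real.log ((weightBall w n (u n)).ncard : ℝ) / n) atTop
      (𝓝 (Real.log (weightEnumerator w 0))) := by
  have : Nonempty α := ⟨hw0.choose⟩
  have hZ0 := weightEnumerator_zero_pos hw0
  refine tendsto_log_div_of_exp_bounds (fun b hb => .of_forall fun n => ?_) fun b hb => ?_
  · calc Real.exp (b * n) ≤ Real.exp (Real.log (weightEnumerator w 0) * n) := by gcongr
      _ = weightEnumerator w 0 ^ n := by rw [← Real.rpow_def_of_pos hZ0, Real.rpow_natCast]
      _ ≤ _ := weightEnumerator_zero_pow_le_ncard_weightBall w n (hu n)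
  · have hlog : ContinuousAt (fun s => Real.log (weightEnumerator w s)) 0 :=
      (continuous_weightEnumerator hw).continuousAt.log hZ0.ne'
    obtain ⟨s, ⟨hbs, hs1⟩, hs : 0 < s⟩ :=
      ((((hlog.eventually_lt_const hb).and (eventually_lt_nhds one_pos)).filter_mono
        nhdsWithin_le_nhds).and (self_mem_nhdsWithin (s := Set.Ioi 0))).exists
    exact eventually_ncard_weightBall_le_exp w hU hs hs1.le (by simpa using hbs)

theorem tendsto_log_ncard_weightBall (hw : ∀ a, 0 ≤ w a) (hw0 : ∃ a, w a = 0)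
    (hwne : ∃ a b, w a ≠ w b) {ρ : ℝ} (hρ : 0 ≤ ρ) (hρ1 : ρ ≤ 1) (hu : ∀ n, 0 ≤ u n)
    (hU : Tendsto (fun n : ℕ => u n / (n : ℝ)) atTop (𝓝 (tiltedMean w ρ))) :
    Tendsto (fun n : ℕ => Real.log ((weightBall w n (u n)).ncard : ℝ) / n) atTop
      (𝓝 (Real.log (weightEnumerator w ρ) - tiltedMean w ρ * Real.log ρ)) := by
  rcases hρ.eq_or_lt with rfl | hpos
  · rw [tiltedMean_zero] at hU ⊢
    simpa using tendsto_log_ncard_weightBall_of_zero hw hw0 hu hU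
  · exact tendsto_log_ncard_weightBall_of_pos hwne hpos hρ1 hU

theorem tendsto_log_ncard_weightBall_of_mean_lt [Nonempty α]
    (hU : Tendsto (fun n : ℕ => u n / (n : ℝ)) atTop (𝓝 U)) (hlt : tiltedMean w 1 < U) :
    Tendsto (fun n : ℕ => Real.log ((weightBall w n (u n)).ncard : ℝ) / n) atTop
      (𝓝 (Real.log (Fintype.card α))) := by
  rw [← weightEnumerator_one w]
  exact tendsto_log_div_of_exp_bounds
    (fun b hb => eventually_exp_le_ncard_weightBall w hU one_pos le_rfl hlt (by simpa using hb))
    fun b hb => eventually_ncard_weightBall_le_exp w hU one_pos le_rfl (by simpa using hb)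

end Growth

end Alphabet

section Subfield

variable (F K : Type*) [Field F] [Field K] [Algebra F K]

theorem subfieldWeight_nonneg {lam : ℝ} (hlam : 0 ≤ lam) (x : K) :
    0 ≤ subfieldWeight F lam x := by
  unfold subfieldWeight
  split_ifs <;> positivity

theorem subfieldWeight_zero (lam : ℝ) : subfieldWeight F lam (0 : K) = 0 := by
  simp [subfieldWeight]

theorem subfieldWeight_algebraMap (lam : ℝ) {a : F} (ha : a ≠ 0) :
    subfieldWeight F lam (algebraMap F K a) = 1 := by
  simp [subfieldWeight, ha]

variable {F K} in
theorem subfieldWeight_of_notMem_range (lam : ℝ) {x : K} (hx : x ∉ Set.range (algebraMap F K)) :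
    subfieldWeight F lam x = lam := by
  have hx0 : x ≠ 0 := fun h => hx ⟨0, by rw [map_zero, h]⟩
  rw [subfieldWeight, if_neg hx0, if_neg hx]

theorem exists_subfieldWeight_ne (lam : ℝ) :
    ∃ x y : K, subfieldWeight F lam x ≠ subfieldWeight F lam y :=
  ⟨algebraMap F K 1, 0, by
    rw [subfieldWeight_algebraMap F K lam one_ne_zero, subfieldWeight_zero]
    exact one_ne_zero⟩

variable [Fintype K]

theorem sum_comp_subfieldWeight {R : Type*} [Ring R] (lam : ℝ) (g : ℝ → R) :
    ∑ x : K, g (subfieldWeight F lam x) =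
      g 0 + ((Nat.card F : R) - 1) * g 1 + ((Nat.card K : R) - Nat.card F) * g lam := by
  classical
  have hinj := (algebraMap F K).injective
  have : Fintype F := Fintype.ofInjective _ hinj
  have hinside : ∑ x ∈ Finset.univ.image (algebraMap F K), g (subfieldWeight F lam x) =
      g 0 + ((Nat.card F : R) - 1) * g 1 := by
    have hunits : ∀ a ∈ Finset.univ.erase (0 : F),
        g (subfieldWeight F lam (algebraMap F K a)) = g 1 := fun a ha => by
      rw [subfieldWeight_algebraMap F K lam (Finset.ne_of_mem_erase ha)]
    rw [Finset.sum_image hinj.injOn, ← Finset.add_sum_erase _ _ (Finset.mem_univ (0 : F)), map_zero,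
      subfieldWeight_zero, Finset.sum_congr rfl hunits, Finset.sum_const, nsmul_eq_mul,
      Finset.card_erase_of_mem (Finset.mem_univ _), Finset.card_univ,
      Nat.cast_pred Fintype.card_pos, Nat.card_eq_fintype_card]
  have houtside : ∑ x ∈ (Finset.univ.image (algebraMap F K))ᶜ, g (subfieldWeight F lam x) =
      ((Nat.card K : R) - Nat.card F) * g lam := by
    have hconst : ∀ x ∈ (Finset.univ.image (algebraMap F K))ᶜ,
        g (subfieldWeight F lam x) = g lam := fun x hx => by
      rw [subfieldWeight_of_notMem_range lam (by simpa using hx)]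
    rw [Finset.sum_congr rfl hconst, Finset.sum_const, nsmul_eq_mul, Finset.card_compl,
      Nat.cast_sub (Finset.card_le_univ _), Finset.card_image_of_injective _ hinj,
      Finset.card_univ, Nat.card_eq_fintype_card, Nat.card_eq_fintype_card]
  rw [← Finset.sum_add_sum_compl (Finset.univ.image (algebraMap F K)), hinside, houtside]

theorem weightEnumerator_subfieldWeight (lam s : ℝ) :
    weightEnumerator (subfieldWeight F lam : K → ℝ) s =
      subfieldEnumerator (Nat.card F) (Module.finrank F K) lam s := by
  rw [weightEnumerator, sum_comp_subfieldWeight F K lam fun t => s ^ t, subfieldEnumerator,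
    Module.natCard_eq_pow_finrank (K := F) (V := K), Nat.cast_pow, Real.rpow_zero, Real.rpow_one]

theorem tiltedMean_subfieldWeight (lam s : ℝ) :
    tiltedMean (subfieldWeight F lam : K → ℝ) s =
      (s * ((Nat.card F : ℝ) - 1) +
          lam * ((Nat.card F : ℝ) ^ Module.finrank F K - Nat.card F) * s ^ lam) /
        (1 + s * ((Nat.card F : ℝ) - 1) +
          ((Nat.card F : ℝ) ^ Module.finrank F K - Nat.card F) * s ^ lam) := by
  rw [tiltedMean, weightEnumerator_subfieldWeight, subfieldEnumerator,
    sum_comp_subfieldWeight F K lam fun t => t * s ^ t,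
    Module.natCard_eq_pow_finrank (K := F) (V := K), Nat.cast_pow, Real.rpow_one]
  ring_nf

end Subfield

theorem mainTheorem8_general (F K : Type*) [Field F] [Field K] [Finite K] [Algebra F K]
    (q m : ℕ) (hq : Nat.card F = q) (hm : Module.finrank F K = m)
    (lam : ℝ) (hlam : 0 ≤ lam)
    (u : ℕ → ℝ) (hu : ∀ n, 0 ≤ u n)
    (U : ℝ) (hU : Tendsto (fun n : ℕ => u n / (n : ℝ)) atTop (𝓝 U))
    (ρ : ℝ) (hρ : 0 ≤ ρ)
    (hsol : U = (ρ * ((q : ℝ) - 1) + lam * ((q : ℝ) ^ m - q) * ρ ^ lam) /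
      (1 + ρ * ((q : ℝ) - 1) + ((q : ℝ) ^ m - q) * ρ ^ lam)) :
    (ρ ≤ 1 →
      Tendsto
        (fun n : ℕ => 1 / (n : ℝ) *
          Real.logb ((q : ℝ) ^ m) ((subfieldBall F K lam n (u n)).ncard : ℝ))
        atTop
        (𝓝 (Real.logb ((q : ℝ) ^ m) (subfieldEnumerator q m lam ρ)
          - U * Real.logb ((q : ℝ) ^ m) ρ))) ∧
    (1 < ρ →
      Tendsto
        (fun n : ℕ => 1 / (n : ℝ) *
          Real.logb ((q : ℝ) ^ m) ((subfieldBall F K lam n (u n)).ncard : ℝ))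
        atTop (𝓝 1)) := by
  have := Fintype.ofFinite K
  subst hq hm
  rw [← tiltedMean_subfieldWeight] at hsol
  subst hsol
  have hcard : (Fintype.card K : ℝ) = (Nat.card F : ℝ) ^ Module.finrank F K := by
    rw [← Nat.card_eq_fintype_card, Module.natCard_eq_pow_finrank (K := F), Nat.cast_pow]
  constructor
  · intro hρ1
    have hgrowth := tendsto_log_ncard_weightBall (subfieldWeight_nonneg F K hlam)
      ⟨0, subfieldWeight_zero F K lam⟩ (exists_subfieldWeight_ne F K lam) hρ hρ1 hu hU
    rw [weightEnumerator_subfieldWeight] at hgrowth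
    rw [Real.logb, Real.logb, ← mul_div_assoc, ← sub_div]
    exact tendsto_one_div_mul_logb hgrowth
  · intro hρ1
    have hmean := strictMonoOn_tiltedMean (exists_subfieldWeight_ne F K lam) (Set.mem_Ioi.2 one_pos)
      (Set.mem_Ioi.2 (one_pos.trans hρ1)) hρ1
    have hbase : Real.log (Fintype.card K) ≠ 0 :=
      (Real.log_pos (Nat.one_lt_cast.2 Fintype.one_lt_card)).ne'
    have hgrowth := tendsto_one_div_mul_logb (b := Fintype.card K)
      (tendsto_log_ncard_weightBall_of_mean_lt hU hmean)
    rwa [div_self hbase, hcard] at hgrowth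

theorem mainTheorem8 (F K : Type*) [Field F] [Finite F] [Field K] [Finite K] [Algebra F K]
    (q m : ℕ) (hq : Nat.card F = q) (hm : Module.finrank F K = m)
    (lam : ℝ) (hlam : 1 / 2 ≤ lam)
    (u : ℕ → ℝ) (hu : ∀ n, 0 ≤ u n)
    (U : ℝ) (hU : Tendsto (fun n : ℕ => u n / (n : ℝ)) atTop (𝓝 U))
    (ρ : ℝ) (hρ : 0 ≤ ρ)
    (hsol : U = (ρ * ((q : ℝ) - 1) + lam * ((q : ℝ) ^ m - q) * ρ ^ lam) /
      (1 + ρ * ((q : ℝ) - 1) + ((q : ℝ) ^ m - q) * ρ ^ lam)) :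
    (ρ ≤ 1 →
      Tendsto
        (fun n : ℕ => 1 / (n : ℝ) *
          Real.logb ((q : ℝ) ^ m) ((subfieldBall F K lam n (u n)).ncard : ℝ))
        atTop
        (𝓝 (Real.logb ((q : ℝ) ^ m) (subfieldEnumerator q m lam ρ)
          - U * Real.logb ((q : ℝ) ^ m) ρ))) ∧
    (1 < ρ →
      Tendsto
        (fun n : ℕ => 1 / (n : ℝ) *
          Real.logb ((q : ℝ) ^ m) ((subfieldBall F K lam n (u n)).ncard : ℝ))
        atTop (𝓝 1)) :=
  mainTheorem8_general F K q m hq hm lam (by linarith) u hu U hU ρ hρ hsol
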